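/- Let $\Delta$ be the set of probability distributions $\mathbf p=(p_1,p_2,\ldots)$ on the positive integers, and for $n\ge 1$ let $\Delta^{(n)}=\{\mathbf p\in\Delta : p_i=0 \text{ for all } i>n\}$. For $\mathbf p\in\Delta$ and $\mathbf q=(q_1,q_2,\ldots)$ with $q_i\in[0,1]$ put $$A(\mathbf p,\mathbf q)=\sum_{i=1}^{\infty}p_i\Big(\frac1i\sum_{l=1}^{i}U_{l-1}(\mathbf q)\,q_l\Big),\qquad U_i(\mathbf q)=\prod_{l=1}^{i}\Big(1-\frac{q_l}{l}\Big),\quad U_0(\mathbf q)=1;$$ this is the probability of success in the secretary problem with a random number $N\sim\mathbf p$ of candidates of the strategy that accepts the $i$-th candidate, when it is the best so far and nobody has been accepted yet, with probability $q_i$. For $l\ge 1$ let $\mathbf q^{(l)}$ be the single-threshold strategy $q^{(l)}_i=\mathbf 1[l\le i]$, and let $l^*_n=\lceil n/e^2\rceil$. For every $\epsilon<2/e^2$ there exists $0<\rho<1$ such that, whenever $\hat{\mathbf p}^{(n)}$ is uniformly distributed on the simplex $\Delta^{(n)}$ for each $n\ge 1$, $$\mathbb P\big[A(\hat{\mathbf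 p}^{(n)},\mathbf q^{(l^*_n)})\le\epsilon\big]=O(\rho^n)\quad\text{as } n\to\infty.$$ For every $\epsilon\le 0.03$, moreover, $$\mathbb P\big[A(\hat{\mathbf p}^{(n)},\mathbf q^{(l^*_n)})\le\epsilon\big]=O(2^{-n})\quad\text{as } n\to\infty.$$ -/

import Mathlib

open MeasureTheory ProbabilityTheory Filter Asymptotics

noncomputable section

namespace Secretary

/-- The distributions `p = (p₁, p₂, …)` on the positive integers. They are written as functions
on `ℕ` whose value at the index `0`, which is not used, is `0`. -/
def simplex : Set (ℕ → ℝ) :=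
  {p | p 0 = 0 ∧ (∀ i, 0 ≤ p i) ∧ HasSum p 1}

/-- The distributions supported on `{1, …, n}`. -/
def simplexUpTo (n : ℕ) : Set (ℕ → ℝ) :=
  {p | p ∈ simplex ∧ ∀ i, n < i → p i = 0}

/-- The affine chart of the hyperplane `p₁ + ⋯ + pₙ = 1` (for `n ≥ 1`) by its first `n - 1`
coordinates: `(y₁, …, yₙ₋₁) ↦ (y₁, …, yₙ₋₁, 1 - ∑ yⱼ, 0, 0, …)`. -/
def chart (n : ℕ) (y : Fin (n - 1) → ℝ) : ℕ → ℝ := fun i =>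
  if i = 0 then 0
  else if h : i - 1 < n - 1 then y ⟨i - 1, h⟩
  else if i = n then 1 - ∑ j, y j
  else 0

/-- The uniform distribution on the simplex of distributions supported on `{1, …, n}`, `n ≥ 1`,
that is, the Dirichlet distribution with parameters `(1, …, 1)`: in the chart above it is
normalized Lebesgue measure on the points that represent elements of the simplex. -/
def uniformSimplex (n : ℕ) : Measure (ℕ → ℝ) :=
  ((volume : Measure (Fin (n - 1) → ℝ))[|chart n ⁻¹' simplexUpTo n]).map (chart n)

/-- `U i q = ∏_{l = 1}^{i} (1 - q_l / l)`, the probability that the strategy with acceptance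
probabilities `q` accepts none of the first `i` numbers. -/
def U (i : ℕ) (q : ℕ → ℝ) : ℝ :=
  ∏ l ∈ Finset.Icc 1 i, (1 - q l / l)

/-- The success probability
`A(p, q) = ∑_{i ≥ 1} p_i * ((1 / i) * ∑_{l = 1}^{i} U_{l-1}(q) * q_l)` of the strategy `q` when
the number of candidates has distribution `p` (the term at `i = 0` is `0`). -/
def A (p q : ℕ → ℝ) : ℝ :=
  ∑' i : ℕ, p i * ((1 / (i : ℝ)) * ∑ l ∈ Finset.Icc 1 i, U (l - 1) q * q l)

/-- The single-threshold strategy: reject the first `l - 1` numbers, then accept the first number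
that is the largest so far. -/
def threshold (l : ℕ) : ℕ → ℝ := fun i => if l ≤ i then 1 else 0

/-- `⌈n / e²⌉`. -/
def lStar (n : ℕ) : ℕ := ⌈(n : ℝ) / Real.exp 1 ^ 2⌉₊

end Secretary

end

/-! `A p q` is linear in `p`: it is `∑ p i * a i`, where `a i = success q i` is the success
probability with exactly `i` candidates. A uniform point of the simplex is a vector of independent
exponentials divided by its sum, so a Chernoff argument applies: for positive weights `w i`, the
probability of `∑ p i * w i ≤ 1` is at most `∏ (w i)⁻¹` (`volume_corner_le`). With `w i = 1 + t * (a
i - ε)` and `t ≥ 0`, the event `A ≤ ε` implies `∑ p i * w i ≤ 1` (`uniformSimplex_sum_le`).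

For the first claim, `∑ a i ≥ 2n/e² - 4` (`sum_success_lStar_ge`), so for `ε < 2/e²` a small `t`
makes the product exponentially small. For the second, `t = 25` works: every weight is at least
`1/4`, and those with `i ≥ n/4` are at least `4`, because there `a i ≥ 0.15` (`success_lStar_ge`).
-/

open scoped ENNReal

namespace Secretary

/-! ### Success probabilities of threshold strategies -/

/-- The probability of success of the strategy `q` when the number of candidates is `i`. -/
noncomputable def success (q : ℕ → ℝ) (i : ℕ) : ℝ :=
  (1 / (i : ℝ)) * ∑ l ∈ Finset.Icc 1 i, U (l - 1) q * q l

theorem A_eq_sum {p : ℕ → ℝ} {n : ℕ} (hp : ∀ i, n < i → p i = 0) (q : ℕ → ℝ) :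
    A p q = ∑ i ∈ Finset.Icc 1 n, p i * success q i := by
  refine tsum_eq_sum fun i hi => ?_
  rcases Nat.eq_zero_or_pos i with rfl | h
  · simp
  · rw [hp i (by simp at hi; omega), zero_mul]

theorem U_succ (i : ℕ) (q : ℕ → ℝ) : U (i + 1) q = U i q * (1 - q (i + 1) / ((i : ℝ) + 1)) := by
  rw [U, U, Finset.prod_Icc_succ_top (by omega)]
  push_cast
  rfl

theorem threshold_mem (l i : ℕ) : 0 ≤ threshold l i ∧ threshold l i ≤ 1 := by
  unfold threshold
  split_ifs <;> norm_num

theorem U_threshold_mem (l i : ℕ) : 0 ≤ U i (threshold l) ∧ U i (threshold l) ≤ 1 := by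
  have h : ∀ k ∈ Finset.Icc 1 i, 0 ≤ 1 - threshold l k / (k : ℝ) ∧ 1 - threshold l k / (k : ℝ) ≤ 1 := by
    intro k hk
    have hk1 : (1 : ℝ) ≤ k := by exact_mod_cast (Finset.mem_Icc.1 hk).1
    obtain ⟨h0, h1⟩ := threshold_mem l k
    have : threshold l k / (k : ℝ) ≤ 1 := (div_le_one (by linarith)).2 (by linarith)
    have := div_nonneg h0 (by linarith : (0 : ℝ) ≤ k)
    constructor <;> linarith
  exact ⟨Finset.prod_nonneg fun k hk => (h k hk).1,
    Finset.prod_le_one (fun k hk => (h k hk).1) fun k hk => (h k hk).2⟩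

theorem success_threshold_nonneg (l i : ℕ) : 0 ≤ success (threshold l) i :=
  mul_nonneg (by positivity) (Finset.sum_nonneg fun k _ =>
    mul_nonneg (U_threshold_mem l (k - 1)).1 (threshold_mem l k).1)

theorem success_threshold_le_one (l i : ℕ) : success (threshold l) i ≤ 1 := by
  have h : ∑ k ∈ Finset.Icc 1 i, U (k - 1) (threshold l) * threshold l k ≤ i := by
    calc _ ≤ ∑ k ∈ Finset.Icc 1 i, (1 : ℝ) := Finset.sum_le_sum fun k _ =>
          mul_le_one₀ (U_threshold_mem l (k - 1)).2 (threshold_mem l k).1 (threshold_mem l k).2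
      _ = i := by simp
  rw [success, one_div, inv_mul_eq_div]
  exact div_le_one_of_le₀ h (by positivity)

theorem U_threshold_of_lt {l i : ℕ} (h : i < l) : U i (threshold l) = 1 :=
  Finset.prod_eq_one fun k hk => by
    have : ¬ l ≤ k := by have := (Finset.mem_Icc.1 hk).2; omega
    simp [threshold, this]

/-- The factors `1 - 1/l` for `m < l ≤ i` telescope. -/
theorem U_threshold {m i : ℕ} (hm : 1 ≤ m) (h : m ≤ i) :
    U i (threshold (m + 1)) = m / i := by
  have hm' : (0 : ℝ) < m := by exact_mod_cast hm
  induction i, h using Nat.le_induction with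
  | base => rw [U_threshold_of_lt (by omega), div_self hm'.ne']
  | succ i hi ih =>
    have hi' : (0 : ℝ) < i := by exact_mod_cast (by omega : 0 < i)
    have : threshold (m + 1) (i + 1) = 1 := if_pos (by omega)
    rw [U_succ, ih, this]
    push_cast
    field_simp
    ring

theorem log_succ_le {i : ℕ} (hi : 0 < i) :
    Real.log ((i : ℝ) + 1) ≤ Real.log i + 1 / i := by
  have hi' : (0 : ℝ) < i := by exact_mod_cast hi
  have := Real.log_le_sub_one_of_pos (show 0 < ((i : ℝ) + 1) / i by positivity)
  rw [Real.log_div (by positivity) hi'.ne', add_div, div_self hi'.ne'] at this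
  linarith

/-- By `U_threshold` the sum is `m * ∑ 1/k` over `m ≤ k < i`, and this harmonic sum dominates `log
(i / m)`. -/
theorem success_threshold_ge {m i : ℕ} (hm : 1 ≤ m) (h : m ≤ i) :
    (m / i : ℝ) * Real.log (i / m) ≤ success (threshold (m + 1)) i := by
  have hm' : (0 : ℝ) < m := by exact_mod_cast hm
  have key : (m : ℝ) * (Real.log i - Real.log m) ≤
      ∑ k ∈ Finset.Icc 1 i, U (k - 1) (threshold (m + 1)) * threshold (m + 1) k := by
    induction i, h using Nat.le_induction with
    | base =>
      rw [sub_self, mul_zero]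
      exact Finset.sum_nonneg fun k _ => mul_nonneg (U_threshold_mem _ _).1 (threshold_mem _ _).1
    | succ i hi ih =>
      have : threshold (m + 1) (i + 1) = 1 := if_pos (by omega)
      rw [Finset.sum_Icc_succ_top (by omega), Nat.add_sub_cancel, U_threshold hm hi, this, mul_one]
      have := mul_le_mul_of_nonneg_left (log_succ_le (by omega : 0 < i)) hm'.le
      rw [mul_add, mul_one_div] at this
      push_cast
      linarith
  have hi' : (0 : ℝ) < i := by exact_mod_cast (by omega : 0 < i)
  rw [success, Real.log_div hi'.ne' hm'.ne', div_mul_eq_mul_div, one_div, inv_mul_eq_div]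
  gcongr

/-- The sum over the numbers of candidates of the bound of `success_threshold_ge`, compared with
the increments of `(log x) ^ 2 / 2`. -/
theorem sum_success_threshold_ge {m n : ℕ} (hm : 1 ≤ m) (h : m ≤ n) :
    (m : ℝ) ^ 2 / (m + 1) * (Real.log (n / m) ^ 2 / 2) ≤
      ∑ i ∈ Finset.Icc 1 n, success (threshold (m + 1)) i := by
  have hm' : (0 : ℝ) < m := by exact_mod_cast hm
  induction n, h using Nat.le_induction with
  | base =>
    rw [div_self hm'.ne', Real.log_one]
    simpa using Finset.sum_nonneg fun i _ => success_threshold_nonneg (m + 1) i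
  | succ n hn ih =>
    have hmn : (m : ℝ) ≤ n := by exact_mod_cast hn
    have hn' : (0 : ℝ) < n := by linarith
    rw [Finset.sum_Icc_succ_top (by omega)]
    have h1 := success_threshold_ge hm (by omega : m ≤ n + 1)
    push_cast at h1 ⊢
    set a := Real.log (n / m) with ha
    set b := Real.log (((n : ℝ) + 1) / m) with hb
    have ha0 : 0 ≤ a := Real.log_nonneg ((one_le_div hm').2 hmn)
    have hab : a ≤ b := Real.log_le_log (by positivity) (by gcongr; linarith)
    have hba : b - a ≤ 1 / n := by
      have := log_succ_le (by omega : 0 < n)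
      rw [ha, hb, Real.log_div hn'.ne' hm'.ne', Real.log_div (by positivity) hm'.ne']
      linarith
    have h2 : b ^ 2 / 2 - a ^ 2 / 2 ≤ b / n := by
      rw [div_eq_mul_one_div b]
      nlinarith [mul_le_mul_of_nonneg_left hba (ha0.trans hab)]
    -- The increment of `log ^ 2 / 2` carries `1/n` where the summand has `1/(n + 1)`; the factor
    -- `m/(m + 1)` pays for the difference.
    have h3 : (m : ℝ) ^ 2 / (m + 1) * (b / n) ≤ m / ((n : ℝ) + 1) * b := by
      have : (m : ℝ) / (m + 1) ≤ n / (n + 1) := by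
        rw [div_le_div_iff₀ (by positivity) (by positivity)]; nlinarith
      calc (m : ℝ) ^ 2 / (m + 1) * (b / n) = (m / (m + 1)) * (m * b / n) := by ring
        _ ≤ (n / (n + 1)) * (m * b / n) := by
          gcongr
          exact div_nonneg (mul_nonneg hm'.le (ha0.trans hab)) hn'.le
        _ = m / ((n : ℝ) + 1) * b := by field_simp
    have h4 := mul_le_mul_of_nonneg_left h2 (by positivity : 0 ≤ (m : ℝ) ^ 2 / (m + 1))
    rw [mul_sub] at h4
    linarith

/-! ### Laplace transforms and the exponential bound on the simplex -/

theorem lintegral_exp_neg_mul_Ioi {w : ℝ} (hw : 0 < w) (a : ℝ) :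
    ∫⁻ s in Set.Ioi a, ENNReal.ofReal (Real.exp (-w * s)) =
      ENNReal.ofReal (Real.exp (-w * a) / w) := by
  rw [← ofReal_integral_eq_lintegral_ofReal (integrableOn_exp_mul_Ioi (by linarith) a)
    (ae_of_all _ fun s => (Real.exp_pos _).le), integral_exp_mul_Ioi (by linarith), neg_div_neg_eq]

/-- The Laplace transform of Lebesgue measure on the positive orthant. -/
theorem lintegral_orthant_exp {m : ℕ} {w : Fin m → ℝ} (hw : ∀ j, 0 < w j) :
    ∫⁻ x in {x : Fin m → ℝ | ∀ j, 0 ≤ x j}, ENNReal.ofReal (Real.exp (-∑ j, w j * x j)) =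
      ENNReal.ofReal (∏ j, (w j)⁻¹) := by
  have hset : MeasurableSet {x : Fin m → ℝ | ∀ j, 0 ≤ x j} := by measurability
  let f : Fin m → ℝ → ℝ := fun j => (Set.Ici 0).indicator fun s => Real.exp (-w j * s)
  have hf : ∀ j, Integrable (f j) := fun j =>
    (integrable_indicator_iff measurableSet_Ici).2
      (integrableOn_Ici_iff_integrableOn_Ioi (by simp) |>.2
        (integrableOn_exp_mul_Ioi (by linarith [hw j]) 0))
  have hint : ∀ j, ∫ s, f j s = (w j)⁻¹ := fun j => by
    rw [integral_indicator measurableSet_Ici, integral_Ici_eq_integral_Ioi,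
      integral_exp_mul_Ioi (by linarith [hw j])]
    simp
  have hf0 : ∀ j s, 0 ≤ f j s := fun j s =>
    Set.indicator_nonneg (fun _ _ => (Real.exp_pos _).le) _
  have hprod : ∀ x : Fin m → ℝ, {x : Fin m → ℝ | ∀ j, 0 ≤ x j}.indicator
      (fun x => ENNReal.ofReal (Real.exp (-∑ j, w j * x j))) x =
        ENNReal.ofReal (∏ j, f j (x j)) := by
    intro x
    by_cases hx : ∀ j, 0 ≤ x j
    · rw [Set.indicator_of_mem (by exact hx), ← Finset.sum_neg_distrib, Real.exp_sum]
      congr 1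
      refine Finset.prod_congr rfl fun j _ => ?_
      rw [← neg_mul]
      exact (Set.indicator_of_mem (show x j ∈ Set.Ici (0 : ℝ) from hx j)
        fun s => Real.exp (-w j * s)).symm
    · rw [Set.indicator_of_notMem (by exact hx)]
      obtain ⟨j, hj⟩ := not_forall.1 hx
      have : f j (x j) = 0 := Set.indicator_of_notMem (show x j ∉ Set.Ici (0 : ℝ) from hj) _
      rw [Finset.prod_eq_zero (Finset.mem_univ j) this, ENNReal.ofReal_zero]
  rw [← lintegral_indicator hset, lintegral_congr hprod, volume_pi,
    ← ofReal_integral_eq_lintegral_ofReal (Integrable.fintype_prod hf)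
      (ae_of_all _ fun x => Finset.prod_nonneg fun j _ => hf0 j _),
    ← volume_pi, integral_fintype_prod_volume_eq_prod]
  simp_rw [hint]

/-- The points with nonnegative coordinates whose sum is at most `s`. -/
def corner (m : ℕ) (s : ℝ) : Set (Fin m → ℝ) := {x | (∀ j, 0 ≤ x j) ∧ ∑ j, x j ≤ s}

theorem measurableSet_corner (m : ℕ) (s : ℝ) : MeasurableSet (corner m s) := by
  unfold corner
  measurability

theorem lintegral_corner_scale {m : ℕ} {s : ℝ} (hs : 0 < s) {F : (Fin m → ℝ) → ℝ≥0∞}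
    (hF : Measurable F) :
    ∫⁻ x in corner m s, F x = ENNReal.ofReal (s ^ m) * ∫⁻ y in corner m 1, F (s • y) := by
  have hpre : ∀ y : Fin m → ℝ, s • y ∈ corner m s ↔ y ∈ corner m 1 := by
    intro y
    simp only [corner, Set.mem_ofPred_eq, Pi.smul_apply, smul_eq_mul, mul_nonneg_iff_of_pos_left hs,
      ← Finset.mul_sum, mul_le_iff_le_one_right hs]
  have hG : Measurable ((corner m s).indicator F) := hF.indicator (measurableSet_corner m s)
  have h1 := congrArg (fun μ => ∫⁻ x, (corner m s).indicator F x ∂μ)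
    (Measure.map_addHaar_smul (volume : Measure (Fin m → ℝ)) hs.ne')
  simp only [lintegral_smul_measure, smul_eq_mul, Module.finrank_fin_fun] at h1
  rw [lintegral_map hG (measurable_const_smul s)] at h1
  have h2 : ∀ y, (corner m s).indicator F (s • y) =
      (corner m 1).indicator (fun y => F (s • y)) y := fun y => by
    by_cases hy : y ∈ corner m 1
    · rw [Set.indicator_of_mem ((hpre y).2 hy), Set.indicator_of_mem hy]
    · rw [Set.indicator_of_notMem (fun h => hy ((hpre y).1 h)), Set.indicator_of_notMem hy]
  rw [lintegral_congr h2, lintegral_indicator (measurableSet_corner m 1),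
    lintegral_indicator (measurableSet_corner m s), abs_of_nonneg (by positivity)] at h1
  rw [h1, ← mul_assoc, ← ENNReal.ofReal_mul (by positivity), mul_inv_cancel₀ (by positivity),
    ENNReal.ofReal_one, one_mul]

/-- The Laplace transform of Lebesgue measure on the positive orthant of dimension `m + 1`, in
the coordinates given by the sum and the normalized first `m` coordinates. -/
theorem lintegral_corner_exp {m : ℕ} {w : Fin m → ℝ} (hw : ∀ j, 0 < w j) {v : ℝ} (hv : 0 < v) :
    ∫⁻ s in Set.Ioi (0 : ℝ), ENNReal.ofReal (s ^ m) * ∫⁻ y in corner m 1,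
      ENNReal.ofReal (Real.exp (-(s * (∑ j, y j * w j + (1 - ∑ j, y j) * v)))) =
      ENNReal.ofReal ((∏ j, (w j)⁻¹) * v⁻¹) := by
  -- Unnormalized coordinates: `x = s • y`, with `s - ∑ j, x j` as the last coordinate. Tonelli then
  -- integrates over `s` first, which leaves the orthant integral times `v⁻¹`.
  let e : ℝ → (Fin m → ℝ) → ℝ := fun s x => Real.exp (-(∑ j, x j * w j + (s - ∑ j, x j) * v))
  let h : ℝ → (Fin m → ℝ) → ℝ≥0∞ := fun s => (corner m s).indicator fun x => ENNReal.ofReal (e s x)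
  have hmeas : Measurable (Function.uncurry h) := by
    have hset : MeasurableSet {z : ℝ × (Fin m → ℝ) | z.2 ∈ corner m z.1} := by
      have hpos : MeasurableSet {z : ℝ × (Fin m → ℝ) | ∀ j, 0 ≤ z.2 j} := by
        simp only [Set.ofPred_forall]
        exact .iInter fun j => measurableSet_le (by fun_prop) (by fun_prop)
      exact hpos.inter (measurableSet_le (f := fun z : ℝ × (Fin m → ℝ) => ∑ j, z.2 j)
        (by fun_prop) (by fun_prop))
    have : Function.uncurry h = {z : ℝ × (Fin m → ℝ) | z.2 ∈ corner m z.1}.indicator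
        fun z => ENNReal.ofReal (e z.1 z.2) := by
      ext ⟨s, x⟩
      by_cases hx : x ∈ corner m s
      · simp [h, hx]
      · simp [h, hx]
    rw [this]
    refine Measurable.indicator ?_ hset
    fun_prop
  have hscale : ∀ s ∈ Set.Ioi (0 : ℝ), ENNReal.ofReal (s ^ m) * ∫⁻ y in corner m 1,
      ENNReal.ofReal (Real.exp (-(s * (∑ j, y j * w j + (1 - ∑ j, y j) * v)))) =
      ∫⁻ x, h s x := by
    intro s hs
    rw [lintegral_indicator (measurableSet_corner m s),
      lintegral_corner_scale hs (by fun_prop)]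
    congr 2
    ext y
    simp only [e, Pi.smul_apply, smul_eq_mul, ← Finset.mul_sum, mul_assoc]
    congr 3
    ring
  have hinner : ∀ x, ∫⁻ s in Set.Ioi (0 : ℝ), h s x =
      {x : Fin m → ℝ | ∀ j, 0 ≤ x j}.indicator
        (fun x => ENNReal.ofReal (Real.exp (-∑ j, w j * x j))) x * ENNReal.ofReal v⁻¹ := by
    intro x
    by_cases hx : ∀ j, 0 ≤ x j
    · have hx0 : 0 ≤ ∑ j, x j := Finset.sum_nonneg fun j _ => hx j
      have hae : ∀ᵐ s ∂(volume.restrict (Set.Ioi (0 : ℝ))), h s x =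
          (Set.Ioi (∑ j, x j)).indicator (fun s =>
            ENNReal.ofReal (Real.exp (-∑ j, w j * x j + v * ∑ j, x j)) *
              ENNReal.ofReal (Real.exp (-v * s))) s := by
        have : ∀ᵐ s : ℝ, s ≠ ∑ j, x j := by simp [ae_iff]
        filter_upwards [ae_restrict_of_ae this] with s hs
        by_cases hsx : ∑ j, x j < s
        · have : x ∈ corner m s := ⟨hx, hsx.le⟩
          rw [Set.indicator_of_mem (by exact hsx), ← ENNReal.ofReal_mul (Real.exp_pos _).le,
            ← Real.exp_add]
          simp only [h, Set.indicator_of_mem this, e]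
          congr 2
          simp only [mul_comm (x _)]
          ring
        · have : x ∉ corner m s := fun h => hsx (lt_of_le_of_ne h.2 hs.symm)
          rw [Set.indicator_of_notMem (by exact hsx)]
          exact Set.indicator_of_notMem this _
      rw [lintegral_congr_ae hae, lintegral_indicator measurableSet_Ioi,
        Measure.restrict_restrict measurableSet_Ioi,
        Set.inter_eq_left.2 (Set.Ioi_subset_Ioi hx0), lintegral_const_mul _ (by fun_prop),
        lintegral_exp_neg_mul_Ioi hv, Set.indicator_of_mem (by exact hx),
        ← ENNReal.ofReal_mul (Real.exp_pos _).le, ← ENNReal.ofReal_mul (Real.exp_pos _).le,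
        div_eq_mul_inv, ← mul_assoc, ← Real.exp_add]
      congr 3
      ring
    · rw [Set.indicator_of_notMem (by exact hx), zero_mul]
      have : ∀ s, h s x = 0 := fun s => Set.indicator_of_notMem (fun h => hx h.1) _
      simp [this]
  have hset : MeasurableSet {x : Fin m → ℝ | ∀ j, 0 ≤ x j} := by measurability
  rw [setLIntegral_congr_fun measurableSet_Ioi hscale, lintegral_lintegral_swap hmeas.aemeasurable,
    lintegral_congr hinner, lintegral_mul_const' _ _ ENNReal.ofReal_ne_top,
    lintegral_indicator hset, lintegral_orthant_exp hw, ENNReal.ofReal_mul]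
  exact Finset.prod_nonneg fun j _ => (inv_pos.2 (hw j)).le

/-- An exponential Chebyshev bound for a linear form on the simplex. -/
theorem volume_corner_le {m : ℕ} {w : Fin m → ℝ} (hw : ∀ j, 0 < w j) {v : ℝ} (hv : 0 < v) :
    (volume (corner m 1))⁻¹ *
        volume (corner m 1 ∩ {y | ∑ j, y j * w j + (1 - ∑ j, y j) * v ≤ 1}) ≤
      ENNReal.ofReal ((∏ j, (w j)⁻¹) * v⁻¹) := by
  set B := {y : Fin m → ℝ | ∑ j, y j * w j + (1 - ∑ j, y j) * v ≤ 1} with hB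
  have hBm : MeasurableSet B := measurableSet_le (by fun_prop) (by fun_prop)
  set G := ∫⁻ s in Set.Ioi (0 : ℝ), ENNReal.ofReal (s ^ m) * ENNReal.ofReal (Real.exp (-s))
    with hG
  -- Unit weights identify the normalizing constant, so neither the Gamma integral nor the volume
  -- has to be evaluated.
  have h1 : G * volume (corner m 1) = 1 := by
    have := lintegral_corner_exp (m := m) (w := fun _ => 1) (fun _ => one_pos) one_pos
    simp only [mul_one, add_sub_cancel, lintegral_const, Measure.restrict_apply_univ, inv_one,
      Finset.prod_const_one, ENNReal.ofReal_one, ← mul_assoc] at this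
    rw [← this, lintegral_mul_const _ (by fun_prop)]
  have h2 : G = (volume (corner m 1))⁻¹ := ENNReal.eq_inv_of_mul_eq_one_left h1
  rw [← h2, ← lintegral_corner_exp hw hv, hG, ← lintegral_mul_const _ (by fun_prop)]
  refine lintegral_mono_ae ((ae_restrict_mem measurableSet_Ioi).mono fun s hs => ?_)
  rw [mul_assoc, ← setLIntegral_const]
  refine mul_le_mul' le_rfl ?_
  calc ∫⁻ _ in corner m 1 ∩ B, ENNReal.ofReal (Real.exp (-s))
      ≤ ∫⁻ y in corner m 1 ∩ B,
        ENNReal.ofReal (Real.exp (-(s * (∑ j, y j * w j + (1 - ∑ j, y j) * v)))) := by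
        refine setLIntegral_mono' ((measurableSet_corner m 1).inter hBm) fun y hy => ?_
        have : s * (∑ j, y j * w j + (1 - ∑ j, y j) * v) ≤ s :=
          mul_le_of_le_one_right (le_of_lt hs) hy.2
        gcongr
    _ ≤ _ := lintegral_mono_set Set.inter_subset_left

/-! ### The chart and the uniform distribution -/

theorem chart_of_lt {n : ℕ} (hn : 1 ≤ n) (y : Fin (n - 1) → ℝ) {i : ℕ} (hi : n < i) :
    chart n y i = 0 := by
  rw [chart, if_neg (by omega), dif_neg (by omega), if_neg (by omega)]

theorem chart_zero (n : ℕ) (y : Fin (n - 1) → ℝ) : chart n y 0 = 0 := if_pos rfl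

theorem chart_succ {n : ℕ} (y : Fin (n - 1) → ℝ) (j : Fin (n - 1)) :
    chart n y (j + 1) = y j := by
  rw [chart, if_neg (by omega), dif_pos (by simp)]
  rfl

theorem chart_self {n : ℕ} (hn : 1 ≤ n) (y : Fin (n - 1) → ℝ) : chart n y n = 1 - ∑ j, y j := by
  rw [chart, if_neg (by omega), dif_neg (by omega), if_pos rfl]

theorem prod_Icc_eq {M : Type*} [CommMonoid M] {n : ℕ} (hn : 1 ≤ n) (f : ℕ → M) :
    ∏ i ∈ Finset.Icc 1 n, f i = (∏ j : Fin (n - 1), f (j + 1)) * f n := by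
  obtain ⟨m, rfl⟩ : ∃ m, n = m + 1 := ⟨n - 1, by omega⟩
  rw [Finset.prod_Icc_succ_top (by omega), Fin.prod_univ_eq_prod_range (fun i => f (i + 1)),
    Nat.add_sub_cancel, Finset.range_eq_Ico, Finset.prod_Ico_add' f 0 m 1]
  rfl

theorem sum_chart_mul {n : ℕ} (hn : 1 ≤ n) (y : Fin (n - 1) → ℝ) (a : ℕ → ℝ) :
    ∑ i ∈ Finset.Icc 1 n, chart n y i * a i =
      ∑ j, y j * a (j + 1) + (1 - ∑ j, y j) * a n := by
  have := prod_Icc_eq (M := Multiplicative ℝ) hn fun i => Multiplicative.ofAdd (chart n y i * a i)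
  refine (show _ = ∑ j : Fin (n - 1), chart n y (j + 1) * a (j + 1) + chart n y n * a n from
    this).trans ?_
  simp only [chart_succ, chart_self hn]

theorem preimage_chart {n : ℕ} (hn : 1 ≤ n) :
    chart n ⁻¹' simplexUpTo n = corner (n - 1) 1 := by
  ext y
  constructor
  · rintro ⟨⟨-, h0, -⟩, -⟩
    refine ⟨fun j => chart_succ y j ▸ h0 _, ?_⟩
    have := h0 n
    rw [chart_self hn] at this
    linarith
  · rintro ⟨h0, h1⟩
    refine ⟨⟨chart_zero n y, fun i => ?_, ?_⟩, fun i hi => chart_of_lt hn y hi⟩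
    · unfold chart
      split_ifs
      · exact le_rfl
      · exact h0 _
      · linarith
      · exact le_rfl
    · have hsum : ∑ i ∈ Finset.Icc 1 n, chart n y i = 1 := by
        have := sum_chart_mul hn y fun _ => 1
        simpa using this
      rw [← hsum]
      refine hasSum_sum_of_ne_finset_zero fun i hi => ?_
      rcases Nat.eq_zero_or_pos i with rfl | h
      · exact chart_zero n y
      · exact chart_of_lt hn y (by simp at hi; omega)

theorem measurable_chart (n : ℕ) : Measurable (chart n) := by
  refine measurable_pi_lambda _ fun i => ?_
  unfold chart
  split_ifs <;> fun_prop

/-- An exponential Chebyshev bound for a linear form under the uniform distribution. -/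
theorem uniformSimplex_sum_le {n : ℕ} (hn : 1 ≤ n) {a : ℕ → ℝ} {t ε : ℝ} (ht : 0 ≤ t)
    (hw : ∀ i, 0 < 1 + t * (a i - ε)) :
    uniformSimplex n {p | (∀ i, n < i → p i = 0) → ∑ i ∈ Finset.Icc 1 n, p i * a i ≤ ε} ≤
      ENNReal.ofReal (∏ i ∈ Finset.Icc 1 n, (1 + t * (a i - ε))⁻¹) := by
  -- The implication restricts to `p` supported up to `n`, where `A` is a finite sum, and the set
  -- stays visibly measurable.
  set E : Set (ℕ → ℝ) := {p | (∀ i, n < i → p i = 0) → ∑ i ∈ Finset.Icc 1 n, p i * a i ≤ ε}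
  have hE : MeasurableSet E := by
    have h1 : MeasurableSet {p : ℕ → ℝ | ∀ i, n < i → p i = 0} := by
      simp only [Set.ofPred_forall]
      exact .iInter fun i => .iInter fun _ => measurableSet_eq_fun (by fun_prop) (by fun_prop)
    have h2 : MeasurableSet {p : ℕ → ℝ | ∑ i ∈ Finset.Icc 1 n, p i * a i ≤ ε} :=
      measurableSet_le (by fun_prop) (by fun_prop)
    have : E = {p : ℕ → ℝ | ∀ i, n < i → p i = 0}ᶜ ∪
        {p : ℕ → ℝ | ∑ i ∈ Finset.Icc 1 n, p i * a i ≤ ε} := by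
      ext p
      exact imp_iff_not_or
    rw [this]
    exact h1.compl.union h2
  rw [uniformSimplex, Measure.map_apply (measurable_chart n) hE, preimage_chart hn,
    cond_apply (measurableSet_corner _ _), prod_Icc_eq hn]
  refine le_trans ?_ (volume_corner_le (fun j : Fin (n - 1) => hw (j + 1)) (hw n))
  gcongr
  intro y hy
  have hy' := hy fun i hi => chart_of_lt hn y hi
  have h1 := sum_chart_mul hn y fun i => 1 + t * (a i - ε)
  have h2 := sum_chart_mul hn y fun _ => (1 : ℝ)
  simp only [mul_one, add_sub_cancel] at h2
  -- As the coordinates sum to `1`, the weighted sum is `1 + t * (∑ p i * a i - ε)`.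
  have h3 : ∑ i ∈ Finset.Icc 1 n, chart n y i * (1 + t * (a i - ε)) =
      (1 - t * ε) * ∑ i ∈ Finset.Icc 1 n, chart n y i +
        t * ∑ i ∈ Finset.Icc 1 n, chart n y i * a i := by
    rw [Finset.mul_sum, Finset.mul_sum, ← Finset.sum_add_distrib]
    exact Finset.sum_congr rfl fun i _ => by ring
  rw [h2, h1] at h3
  change ∑ j, y j * (1 + t * (a (j + 1) - ε)) + (1 - ∑ j, y j) * (1 + t * (a n - ε)) ≤ 1
  rw [h3]
  nlinarith [mul_le_mul_of_nonneg_left hy' ht]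

theorem measureReal_A_le {Ω : Type*} [MeasurableSpace Ω] {P : Measure Ω} {p : Ω → ℕ → ℝ} {n : ℕ}
    (hn : 1 ≤ n) (hp : HasLaw p (uniformSimplex n) P) {q : ℕ → ℝ} {t ε ε' : ℝ} (hε : ε' ≤ ε)
    (ht : 0 ≤ t) (hw : ∀ i, 0 < 1 + t * (success q i - ε)) :
    P.real {ω | A (p ω) q ≤ ε'} ≤ ∏ i ∈ Finset.Icc 1 n, (1 + t * (success q i - ε))⁻¹ := by
  refine ENNReal.toReal_le_of_le_ofReal (Finset.prod_nonneg fun i _ => (inv_pos.2 (hw i)).le) ?_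
  refine le_trans ?_ (uniformSimplex_sum_le hn ht hw)
  rw [← hp.map_eq]
  refine le_trans (measure_mono fun ω hω => ?_) (Measure.le_map_apply hp.aemeasurable _)
  exact fun h => (A_eq_sum h q).symm.le.trans (hω.trans hε)

/-! ### Estimates at the threshold `⌈n / e²⌉` -/

theorem exp_one_sq_mem : 7 < Real.exp 1 ^ 2 ∧ Real.exp 1 ^ 2 < 7.4 := by
  have h1 := Real.exp_one_gt_d9
  have h2 := Real.exp_one_lt_d9
  constructor <;> nlinarith

/-- Here `m` counts the candidates always rejected; `120 / 7.4 > 16` gives `m ≥ 15`. -/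
theorem exists_lStar_eq {n : ℕ} (hn : 120 ≤ n) :
    ∃ m : ℕ, 15 ≤ m ∧ lStar n = m + 1 ∧ m * Real.exp 1 ^ 2 < n ∧
      n ≤ (m + 1) * Real.exp 1 ^ 2 := by
  obtain ⟨h7, h8⟩ := exp_one_sq_mem
  have hn' : (120 : ℝ) ≤ n := by exact_mod_cast hn
  have h16 : 15 < lStar n := by
    refine Nat.lt_ceil.2 ?_
    rw [lt_div_iff₀ (by linarith)]
    push_cast
    linarith
  refine ⟨lStar n - 1, by omega, by omega, ?_, ?_⟩
  · rw [← lt_div_iff₀ (by linarith)]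
    exact Nat.lt_ceil.1 (by unfold lStar at *; omega)
  · rw [← div_le_iff₀ (by linarith)]
    have : ((lStar n - 1 : ℕ) : ℝ) + 1 = lStar n := by
      rw [Nat.cast_sub (by omega)]; push_cast; ring
    rw [this]
    exact Nat.le_ceil _

/-- By concavity it is enough to compare at the endpoints `3/2` and `8`. -/
theorem le_log_of_mem_Icc {u : ℝ} (h1 : 3 / 2 ≤ u) (h2 : u ≤ 8) : 3 / 20 * u ≤ Real.log u := by
  have hconc := strictConcaveOn_log_Ioi.concaveOn.2
    (show (3 / 2 : ℝ) ∈ Set.Ioi 0 by norm_num) (show (8 : ℝ) ∈ Set.Ioi 0 by norm_num)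
    (show 0 ≤ (8 - u) / (13 / 2) by apply div_nonneg <;> linarith)
    (show 0 ≤ (u - 3 / 2) / (13 / 2) by apply div_nonneg <;> linarith) (by ring)
  have hu : (8 - u) / (13 / 2) * (3 / 2) + (u - 3 / 2) / (13 / 2) * 8 = u := by ring
  simp only [smul_eq_mul, hu] at hconc
  have hlo : (1 / 3 : ℝ) ≤ Real.log (3 / 2) := by
    have := Real.one_sub_inv_le_log_of_pos (show (0 : ℝ) < 3 / 2 by norm_num)
    norm_num at this ⊢
    linarith
  have hhi : (2 : ℝ) ≤ Real.log 8 := by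
    have := Real.log_two_gt_d9
    rw [show (8 : ℝ) = 2 ^ 3 by norm_num, Real.log_pow]
    push_cast
    linarith
  have ha := mul_le_mul_of_nonneg_left hlo
    (show 0 ≤ (8 - u) / (13 / 2) by apply div_nonneg <;> linarith)
  have hb := mul_le_mul_of_nonneg_left hhi
    (show 0 ≤ (u - 3 / 2) / (13 / 2) by apply div_nonneg <;> linarith)
  linarith

theorem success_lStar_ge {n i : ℕ} (hn : 120 ≤ n) (hi : n ≤ 4 * i) (hin : i ≤ n) :
    0.15 ≤ success (threshold (lStar n)) i := by
  obtain ⟨h7, h8⟩ := exp_one_sq_mem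
  obtain ⟨m, hm, hl, hlt, hle⟩ := exists_lStar_eq hn
  have hm' : (15 : ℝ) ≤ m := by exact_mod_cast hm
  have hi' : (n : ℝ) ≤ 4 * i := by exact_mod_cast hi
  have hin' : (i : ℝ) ≤ n := by exact_mod_cast hin
  have hmi : (3 / 2 : ℝ) * m ≤ i := by nlinarith
  have hi0 : (0 : ℝ) < i := by linarith
  -- `i / m ≤ 8` because `i ≤ n ≤ 7.4 * (m + 1)` and `m ≥ 15`.
  have h := le_log_of_mem_Icc (u := i / m) ((le_div_iff₀ (by linarith)).2 hmi)
    ((div_le_iff₀ (by linarith)).2 (by nlinarith))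
  rw [hl]
  refine le_trans ?_ (success_threshold_ge (by omega) (by
    have : (m : ℝ) ≤ i := by linarith
    exact_mod_cast this))
  calc (0.15 : ℝ) = m / i * (3 / 20 * (i / m)) := by field_simp; norm_num
    _ ≤ _ := by gcongr

/-- Since `log (n / m) ≥ 2`, the sum is at least `2m²/(m + 1) ≥ 2(m + 1) - 4`, and `m + 1 ≥ n/e²`.
-/
theorem sum_success_lStar_ge {n : ℕ} (hn : 120 ≤ n) :
    n * (2 / Real.exp 1 ^ 2) - 4 ≤ ∑ i ∈ Finset.Icc 1 n, success (threshold (lStar n)) i := by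
  obtain ⟨h7, h8⟩ := exp_one_sq_mem
  obtain ⟨m, hm, hl, hlt, hle⟩ := exists_lStar_eq hn
  have hm' : (15 : ℝ) ≤ m := by exact_mod_cast hm
  rw [hl]
  have hmn : (m : ℝ) ≤ n := by nlinarith
  refine le_trans ?_ (sum_success_threshold_ge (by omega) (by exact_mod_cast hmn))
  have hlog : 2 ≤ Real.log (n / m) := by
    rw [Real.le_log_iff_exp_le (div_pos (by linarith) (by linarith)),
      le_div_iff₀ (by linarith), show (2 : ℝ) = (2 : ℕ) * 1 by norm_num, Real.exp_nat_mul]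
    linarith
  have h1 : (n : ℝ) * (2 / Real.exp 1 ^ 2) ≤ 2 * (m + 1) := by
    rw [mul_div_assoc', div_le_iff₀ (by linarith)]
    linarith
  have h2 : (m : ℝ) - 1 ≤ (m : ℝ) ^ 2 / (m + 1) := by
    rw [le_div_iff₀ (by linarith)]
    nlinarith
  have h3 : 2 ≤ Real.log (n / m) ^ 2 / 2 := by nlinarith
  have h4 : (0 : ℝ) ≤ (m : ℝ) ^ 2 / (m + 1) := by positivity
  nlinarith [mul_le_mul_of_nonneg_left h3 h4]

/-! ### Bounds for the product of inverse weights -/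

theorem inv_one_add_le_exp {x t : ℝ} (hx : |x| ≤ t) (ht : t ≤ 1 / 2) :
    (1 + x)⁻¹ ≤ Real.exp (-x + 2 * t ^ 2) := by
  obtain ⟨h1, h2⟩ := abs_le.1 hx
  have hpos : 0 < 1 + x := by linarith
  rw [← Real.exp_log (inv_pos.2 hpos), Real.log_inv, Real.exp_le_exp]
  have h3 := Real.one_sub_inv_le_log_of_pos hpos
  have h4 : x - 2 * t ^ 2 ≤ 1 - (1 + x)⁻¹ := by
    have : 1 - (1 + x)⁻¹ = x / (1 + x) := by field_simp; ring
    rw [this, le_div_iff₀ hpos]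
    have h5 : x ^ 2 ≤ t ^ 2 := sq_le_sq' h1 h2
    nlinarith [mul_nonneg (sq_nonneg t) (by linarith : 0 ≤ 1 + 2 * x)]
  linarith

/-- The exponential moment bound with a small parameter. -/
theorem prod_inv_le_exp {n : ℕ} {f : ℕ → ℝ} (hf : ∀ i, 0 ≤ f i ∧ f i ≤ 1) {ε δ : ℝ}
    (hε0 : 0 ≤ ε) (hε1 : ε ≤ 1) (hδ0 : 0 ≤ δ) (hδ1 : δ ≤ 1)
    (hsum : n * (ε + δ) ≤ ∑ i ∈ Finset.Icc 1 n, f i) :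
    ∏ i ∈ Finset.Icc 1 n, (1 + δ / 4 * (f i - ε))⁻¹ ≤ Real.exp (-(δ ^ 2 / 8)) ^ n := by
  have habs : ∀ i, |δ / 4 * (f i - ε)| ≤ δ / 4 := fun i => by
    obtain ⟨h0, h1⟩ := hf i
    rw [abs_mul, abs_of_nonneg (by linarith : 0 ≤ δ / 4)]
    exact mul_le_of_le_one_right (by linarith) (abs_le.2 ⟨by linarith, by linarith⟩)
  calc ∏ i ∈ Finset.Icc 1 n, (1 + δ / 4 * (f i - ε))⁻¹
      ≤ ∏ i ∈ Finset.Icc 1 n, Real.exp (-(δ / 4 * (f i - ε)) + 2 * (δ / 4) ^ 2) :=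
        Finset.prod_le_prod
          (fun i _ => inv_nonneg.2 (by linarith [(abs_le.1 (habs i)).1]))
          (fun i _ => inv_one_add_le_exp (habs i) (by linarith))
    _ = Real.exp (-(δ / 4 * (∑ i ∈ Finset.Icc 1 n, f i - n * ε)) + n * (2 * (δ / 4) ^ 2)) := by
        rw [← Real.exp_sum, Finset.sum_add_distrib, Finset.sum_neg_distrib, ← Finset.mul_sum,
          Finset.sum_sub_distrib]
        simp
    _ ≤ Real.exp (n * -(δ ^ 2 / 8)) := by
        refine Real.exp_le_exp.2 ?_
        -- Per factor, the gain `δ²/4` exceeds the quadratic loss `δ²/8`.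
        nlinarith [mul_le_mul_of_nonneg_left hsum (by linarith : 0 ≤ δ / 4)]
    _ = _ := Real.exp_nat_mul _ _

/-- With `k ≤ n/4` indices below `n/4`, the product is at most `4^k * 4^(k - n) = 2^(4k - 2n) ≤
2^(-n)`. -/
theorem prod_inv_le_half_pow {n : ℕ} {w : ℕ → ℝ} (hw : ∀ i, 1 / 4 ≤ w i)
    (hw' : ∀ i, n ≤ 4 * i → i ≤ n → 4 ≤ w i) :
    ∏ i ∈ Finset.Icc 1 n, (w i)⁻¹ ≤ (1 / 2) ^ n := by
  have h1 : ∏ i ∈ Finset.Icc 1 n, (w i)⁻¹ ≤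
      ∏ i ∈ Finset.Icc 1 n, if 4 * i < n then (4 : ℝ) else 1 / 4 := by
    refine Finset.prod_le_prod (fun i _ => inv_nonneg.2 (by linarith [hw i])) fun i hi => ?_
    split_ifs with h
    · exact inv_le_of_inv_le₀ (by norm_num) (by linarith [hw i])
    · rw [← one_div]
      exact one_div_le_one_div_of_le (by norm_num) (hw' i (by omega) (Finset.mem_Icc.1 hi).2)
  refine h1.trans ?_
  rw [Finset.prod_ite, Finset.prod_const, Finset.prod_const]
  have hcard := Finset.card_filter_add_card_filter_not (s := Finset.Icc 1 n) (fun i => 4 * i < n)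
  set k := (Finset.filter (fun i => 4 * i < n) (Finset.Icc 1 n)).card with hk
  have hk4 : k ≤ n / 4 := by
    have : Finset.filter (fun i => 4 * i < n) (Finset.Icc 1 n) ⊆ Finset.Icc 1 (n / 4) := by
      intro i hi
      simp only [Finset.mem_filter, Finset.mem_Icc] at hi ⊢
      omega
    simpa using Finset.card_le_card this
  rw [Nat.card_Icc] at hcard
  obtain ⟨r, hr⟩ : ∃ r, n = 4 * k + r := ⟨n - 4 * k, by omega⟩
  have hc : (Finset.filter (fun i => ¬ 4 * i < n) (Finset.Icc 1 n)).card = k + (2 * k + r) := by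
    omega
  rw [hc, pow_add, ← mul_assoc, ← mul_pow]
  norm_num only [one_pow, one_mul]
  rw [show (1 / 4 : ℝ) = (1 / 2) ^ 2 by norm_num, ← pow_mul]
  exact pow_le_pow_of_le_one (by norm_num) (by norm_num) (by omega)

theorem isBigO_pow_of_eventually_le {f : ℕ → ℝ} {r : ℝ} (hf : ∀ n, 0 ≤ f n)
    (h : ∀ᶠ n in atTop, f n ≤ r ^ n) : f =O[atTop] fun n => r ^ n :=
  IsBigO.of_bound 1 (h.mono fun n hn => by
    rw [one_mul, Real.norm_of_nonneg (hf n)]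
    exact hn.trans (le_abs_self _))

end Secretary

theorem theorem3 :
    (∀ ε : ℝ, ε < 2 / Real.exp 1 ^ 2 →
      ∃ ρ : ℝ, 0 < ρ ∧ ρ < 1 ∧
        ∀ (Ω : ℕ → Type*) [∀ n, MeasurableSpace (Ω n)] (P : ∀ n, Measure (Ω n))
          (p : ∀ n, Ω n → ℕ → ℝ),
          (∀ n, 1 ≤ n → HasLaw (p n) (Secretary.uniformSimplex n) (P n)) →
          (fun n : ℕ => (P n).real
              {ω | Secretary.A (p n ω) (Secretary.threshold (Secretary.lStar n)) ≤ ε})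
            =O[atTop] (fun n : ℕ => ρ ^ n)) ∧
    (∀ ε : ℝ, ε ≤ 0.03 →
        ∀ (Ω : ℕ → Type*) [∀ n, MeasurableSpace (Ω n)] (P : ∀ n, Measure (Ω n))
          (p : ∀ n, Ω n → ℕ → ℝ),
          (∀ n, 1 ≤ n → HasLaw (p n) (Secretary.uniformSimplex n) (P n)) →
          (fun n : ℕ => (P n).real
              {ω | Secretary.A (p n ω) (Secretary.threshold (Secretary.lStar n)) ≤ ε})
            =O[atTop] (fun n : ℕ => (1 / 2 : ℝ) ^ n)) := by
  have hmem : ∀ n i, 0 ≤ Secretary.success (Secretary.threshold (Secretary.lStar n)) i ∧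
      Secretary.success (Secretary.threshold (Secretary.lStar n)) i ≤ 1 := fun n i =>
    ⟨Secretary.success_threshold_nonneg _ i, Secretary.success_threshold_le_one _ i⟩
  constructor
  · intro ε hε
    obtain ⟨h7, -⟩ := Secretary.exp_one_sq_mem
    set c := 2 / Real.exp 1 ^ 2 with hc
    have hc0 : 0 < c := by positivity
    have hc1 : c < 1 := (div_lt_one (by linarith)).2 (by linarith)
    -- `ε` may be negative; enlarging it to `0` only enlarges the event.
    set ε₁ := max ε 0 with hε₁
    have hε₁0 : 0 ≤ ε₁ := le_max_right _ _
    have hε₁c : ε₁ < c := max_lt hε hc0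
    -- Half of the gap drives the decay; the other half absorbs the `-4` once `n * δ ≥ 4`.
    set δ := (c - ε₁) / 2 with hδ
    have hδ0 : 0 < δ := by linarith
    refine ⟨Real.exp (-(δ ^ 2 / 8)), Real.exp_pos _, Real.exp_lt_one_iff.2 (by
      have := pow_pos hδ0 2; linarith), fun Ω _ P p hp => ?_⟩
    refine Secretary.isBigO_pow_of_eventually_le (fun n => measureReal_nonneg) ?_
    filter_upwards [eventually_ge_atTop 120, eventually_ge_atTop ⌈4 / δ⌉₊] with n hn hnδ
    have h4 : 4 ≤ n * δ := (div_le_iff₀ hδ0).1 (Nat.ceil_le.1 hnδ)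
    refine (Secretary.measureReal_A_le (by omega) (hp n (by omega)) (le_max_left ε 0)
      (by linarith : 0 ≤ δ / 4) fun i => ?_).trans
      (Secretary.prod_inv_le_exp (hmem n) hε₁0 (by linarith) hδ0.le (by linarith) ?_)
    · nlinarith [(hmem n i).1]
    · refine le_trans ?_ (Secretary.sum_success_lStar_ge hn)
      rw [← hc, show c = ε₁ + δ + δ by linarith]
      linarith
  · intro ε hε Ω _ P p hp
    refine Secretary.isBigO_pow_of_eventually_le (fun n => measureReal_nonneg) ?_
    filter_upwards [eventually_ge_atTop 120] with n hn
    -- `t = 25` gives `1 - 25 * 0.03 = 1/4` and `1 + 25 * (0.15 - 0.03) = 4`.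
    refine (Secretary.measureReal_A_le (by omega) (hp n (by omega)) hε
      (by norm_num : (0 : ℝ) ≤ 25) fun i => ?_).trans
      (Secretary.prod_inv_le_half_pow (fun i => ?_) fun i h h' => ?_)
    · linarith [(hmem n i).1]
    · linarith [(hmem n i).1]
    · linarith [Secretary.success_lStar_ge hn h h']
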